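/- Let $\Omega\subseteq\mathbb R^2$ be open, let $x_1,\dots,x_N\in\Omega$ be distinct points and let $y_1,\dots,y_N\in\mathbb R$. For $p\in[1,\infty]$ let $p^*$ be the conjugate exponent, $1/p+1/p^*=1$ (with $1/\infty=0$), and for $M\in\mathbb R^{2\times 2}$ let $|M|_p$ be the Schatten $p$-norm, i.e. the $\ell^p$ norm of the singular values of $M$. For $f\in L^1_{\mathrm{loc}}(\Omega)$ define the $p$-Hessian–Schatten variation $$|\mathrm D^2_p f|(\Omega):=\sup_F\int_\Omega \sum_{i,j=1}^2 f\,\partial_i\partial_jF_{i,j}\,d\mathscr L^2\in[0,\infty],$$ where the supremum runs over all $F\in C_c^\infty(\Omega)^{2\times2}$ with $|F(x)|_{p^*}\le 1$ for every $x$. For $q\in[1,\infty]$ and $\lambda\in[0,\infty]$ set $$\mathcal F^{p,q}_\lambda(f):=|\mathrm D^2_pf|(\Omega)+\lambda\,\big\|(f(x_i)-y_i)_{i=1,\dots,N}\big\|_{\ell^q},\qquad f\in L^1_{\mathrm{loc}}(\Omega),$$ with the convention $\infty\cdot0=0$, where $f(x_i)$ is the value of the continuous representative of $f$ whenever there is one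 (functions with $|\mathrm D^2_pf|(\Omega)<\infty$ have one; otherwise $\mathcal F^{p,q}_\lambda(f)=\infty$ whatever values $f(x_i)\in\mathbb R$ are used). Thus $\mathcal F^{p,q}_\infty(f)=|\mathrm D^2_pf|(\Omega)$ if $f(x_i)=y_i$ for all $i$, and $\mathcal F^{p,q}_\infty(f)=\infty$ otherwise. **Proposition.** Let $p,q\in[1,\infty]$ and let $\lambda\in[2\pi\,2^{1/p}N^{1-1/q},\infty]$. Then $$\inf_{f\in L^1_{\mathrm{loc}}(\Omega)}\mathcal F^{p,q}_\lambda(f)=\inf_{f\in L^1_{\mathrm{loc}}(\Omega)}\mathcal F^{p,q}_\infty(f).$$ In particular, for fixed $p$ these infima are independent of $\lambda$ and $q$ in this range: if also $q'\in[1,\infty]$ and $\lambda'\in[2\pi\,2^{1/p}N^{1-1/q'},\infty]$, then $\inf_f\mathcal F^{p,q}_\lambda(f)=\inf_f\mathcal F^{p,q'}_{\lambda'}(f)$. -/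

import Mathlib

open MeasureTheory
open scoped ENNReal ContDiff

namespace HessianSchatten

noncomputable section

/-- The conjugate exponent `p*` of `p ∈ [1, ∞]`, so that `1 / p + 1 / p* = 1`. -/
def conjExp (p : ℝ≥0∞) : ℝ≥0∞ := (1 - p⁻¹)⁻¹

theorem inv_add_inv_conjExp {p : ℝ≥0∞} (hp : 1 ≤ p) : p⁻¹ + (conjExp p)⁻¹ = 1 := by
  rw [conjExp, inv_inv]
  exact add_tsub_cancel_of_le (ENNReal.inv_le_one.2 hp)

/-- The `ℓ^p` norm of a finite family of real numbers, `p ∈ [1, ∞]`. -/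
def ellNorm (p : ℝ≥0∞) {n : ℕ} (v : Fin n → ℝ) : ℝ := ‖WithLp.toLp p v‖

/-- The Schatten `p`-norm of a real square matrix: the `ℓ^p` norm of its singular values,
counted with multiplicity. -/
def schattenNorm (p : ℝ≥0∞) {d : ℕ} (M : Matrix (Fin d) (Fin d) ℝ) : ℝ :=
  ellNorm p fun i : Fin d => (Matrix.toEuclideanLin M).singularValues i

/-- The `i`-th partial derivative of `u`. -/
def partialDeriv {d : ℕ} (i : Fin d) (u : EuclideanSpace ℝ (Fin d) → ℝ) :
    EuclideanSpace ℝ (Fin d) → ℝ :=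
  fun x => fderiv ℝ u x (EuclideanSpace.single i 1)

/-- The admissible test fields on `A`: matrix fields `F` with entries in `C_c^∞(A)` and with
`|F(x)|_{p*} ≤ 1` for every `x` (as `F` is continuous, this says that the `L^∞` norm of
`|F|_{p*}` is at most one). -/
structure IsTestField (p : ℝ≥0∞) {d : ℕ} (A : Set (EuclideanSpace ℝ (Fin d)))
    (F : EuclideanSpace ℝ (Fin d) → Matrix (Fin d) (Fin d) ℝ) : Prop where
  contDiff : ∀ i j, ContDiff ℝ ∞ fun x => F x i j
  hasCompactSupport : ∀ i j, HasCompactSupport fun x => F x i j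
  tsupport_subset : ∀ i j, tsupport (fun x => F x i j) ⊆ A
  norm_le : ∀ x, schattenNorm (conjExp p) (F x) ≤ 1

/-- The `p`-Hessian--Schatten variation `|D²_p f|(A) ∈ [0, ∞]` of `f` on the open set `A`.
The supremum is nonnegative because `F = 0` is admissible, so that truncating the integrals
at zero does not change it. -/
def variation (p : ℝ≥0∞) {d : ℕ} (f : EuclideanSpace ℝ (Fin d) → ℝ)
    (A : Set (EuclideanSpace ℝ (Fin d))) : ℝ≥0∞ :=
  ⨆ (F : EuclideanSpace ℝ (Fin d) → Matrix (Fin d) (Fin d) ℝ) (_ : IsTestField p A F),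
    ENNReal.ofReal (∫ x in A, ∑ i, ∑ j,
      f x * partialDeriv i (partialDeriv j fun z => F z i j) x)

/-- `g` is a continuous representative of `f` on `Ω`. -/
def IsContRep {d : ℕ} (Ω : Set (EuclideanSpace ℝ (Fin d)))
    (f g : EuclideanSpace ℝ (Fin d) → ℝ) : Prop :=
  ContinuousOn g Ω ∧ f =ᵐ[volume.restrict Ω] g

open Classical in
/-- The function used for point evaluations: the continuous representative of `f` on `Ω`
whenever there is one, and `f` itself otherwise. On an open `Ω` the values at points of `Ω`
do not depend on the chosen continuous representative. -/
def contRep {d : ℕ} (Ω : Set (EuclideanSpace ℝ (Fin d)))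
    (f : EuclideanSpace ℝ (Fin d) → ℝ) : EuclideanSpace ℝ (Fin d) → ℝ :=
  if h : ∃ g, IsContRep Ω f g then h.choose else f

/-- `f(x)` is the value of any continuous representative of `f`, if there is one. -/
theorem contRep_eq {d : ℕ} {Ω : Set (EuclideanSpace ℝ (Fin d))} (hΩ : IsOpen Ω)
    {f g : EuclideanSpace ℝ (Fin d) → ℝ} (hg : IsContRep Ω f g)
    {x : EuclideanSpace ℝ (Fin d)} (hx : x ∈ Ω) : contRep Ω f x = g x := by
  have h : ∃ g, IsContRep Ω f g := ⟨g, hg⟩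
  have hc : IsContRep Ω f (contRep Ω f) := by
    rw [contRep, dif_pos h]
    exact h.choose_spec
  exact Measure.eqOn_open_of_ae_eq (hc.2.symm.trans hg.2) hΩ hc.1 hg.1 hx

/-- The functional `𝓕_λ^{p,q}(f) = |D²_p f|(Ω) + λ ‖(f(x_i) - y_i)_i‖_{ℓ^q}` with values in
`[0, ∞]`, for `λ ∈ [0, ∞]`; in `ℝ≥0∞` one has `∞ * 0 = 0`, so for `λ = ∞` the data are
fitted exactly. -/
def functional (Ω : Set (EuclideanSpace ℝ (Fin 2))) {N : ℕ}
    (x : Fin N → EuclideanSpace ℝ (Fin 2)) (y : Fin N → ℝ) (p q lam : ℝ≥0∞)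
    (f : EuclideanSpace ℝ (Fin 2) → ℝ) : ℝ≥0∞ :=
  variation p f Ω + lam * ENNReal.ofReal (ellNorm q fun i => contRep Ω f (x i) - y i)

/-- The infimum of `𝓕_λ^{p,q}` over `L^1_loc(Ω)`. -/
def infFunctional (Ω : Set (EuclideanSpace ℝ (Fin 2))) {N : ℕ}
    (x : Fin N → EuclideanSpace ℝ (Fin 2)) (y : Fin N → ℝ) (p q lam : ℝ≥0∞) : ℝ≥0∞ :=
  ⨅ (f : EuclideanSpace ℝ (Fin 2) → ℝ) (_ : LocallyIntegrableOn f Ω volume),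
    functional Ω x y p q lam f

/-- The threshold `2π 2^{1/p} N^{1 - 1/q}`, with `1 / ∞ = 0`. -/
def threshold (N : ℕ) (p q : ℝ≥0∞) : ℝ :=
  2 * Real.pi * (2 : ℝ) ^ (p⁻¹).toReal * (N : ℝ) ^ (1 - (q⁻¹).toReal)

end

end HessianSchatten

namespace HessianSchatten

/-! Raising `λ` to `∞` can only raise the infimum. For the converse, let `f` be a competitor with
residuals `e i` at the data points, and subtract `∑ e i • φ_i`, where `φ_i` is a bump equal to `1`
at `x i` and `0` at the other data points. The result fits exactly. If each bump costs at most `T (1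
+ ε)` with `T = 2π 2^{1/p}`, the variation grows by at most `T (1 + ε) ∑ |e i|`. By Hölder, `T ∑ |e
i|` is at most the threshold times the `ℓ^q` norm of `e`, which the penalty already pays for; then
let `ε → 0` (`infFunctional_top_le`).

The cheap bump (`exists_bump`) is `h (log ρ)` with `ρ = |z - c|² + δ`. With `a = (z - c)/√ρ`, its
Hessian is `(2/ρ) (h' (I - 2 a⊗a) + 2 h'' a⊗a)`. Since `|a| ≤ 1`, the eigenvalues of `I - 2 a⊗a` lie
in `[-1, 1]`, so its Schatten `p`-norm is at most `2^{1/p}`. In polar coordinates the `h'` term then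
costs at most `2π 2^{1/p} ∫ |h'|`, and `∫ |h'| = 1` because `h` falls monotonically from `1` to `0`.
Spreading this fall over a long interval makes the `h''` term negligible. -/

/-! ### Hölder and Schatten duality for `2 × 2` matrices -/

theorem one_le_toReal_of_one_le {q : ℝ≥0∞} (hq : 1 ≤ q) (hq' : q ≠ ⊤) : 1 ≤ q.toReal := by
  simpa using ENNReal.toReal_mono hq' hq

theorem sum_abs_le_ellNorm {q : ℝ≥0∞} (hq : 1 ≤ q) {n : ℕ} (v : Fin n → ℝ) :
    ∑ i, |v i| ≤ (n : ℝ) ^ (1 - (q⁻¹).toReal) * ellNorm q v := by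
  have : Fact (1 ≤ q) := ⟨hq⟩
  rcases eq_or_ne q ⊤ with rfl | hq'
  · have h : ∀ i ∈ Finset.univ, |v i| ≤ ellNorm ⊤ v := fun i _ => by
      simpa [ellNorm] using PiLp.norm_apply_le (WithLp.toLp ⊤ v) i
    simpa using Finset.sum_le_card_nsmul _ _ _ h
  · have hr := one_le_toReal_of_one_le hq hq'
    set r := q.toReal with hrdef
    have hr0 : 0 < r := by linarith
    have hinv : (q⁻¹).toReal = 1 / r := by rw [ENNReal.toReal_inv, one_div]
    have hE : ellNorm q v = (∑ i, |v i| ^ r) ^ (1 / r) := by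
      simp [ellNorm, PiLp.norm_eq_sum (p := q) hr0, hrdef]
    -- Power mean inequality `(∑ |v i|)^r ≤ n^(r-1) ∑ |v i|^r`; the bound is its `r`-th root.
    have h := Real.rpow_sum_le_const_mul_sum_rpow Finset.univ v hr
    have hS : 0 ≤ ∑ i, |v i| := Finset.sum_nonneg fun i _ => abs_nonneg _
    have hS' : 0 ≤ ∑ i, |v i| ^ r := Finset.sum_nonneg fun i _ => by positivity
    have h2 := Real.rpow_le_rpow (by positivity) h (by positivity : 0 ≤ 1 / r)
    rw [← Real.rpow_mul hS, mul_one_div_cancel hr0.ne', Real.rpow_one,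
      Real.mul_rpow (by positivity) hS', ← Real.rpow_mul (by positivity)] at h2
    rw [hE, hinv]
    convert h2 using 3
    · simp
    · field_simp

theorem one_le_conjExp (p : ℝ≥0∞) : 1 ≤ conjExp p := by
  rw [conjExp, ENNReal.one_le_inv]
  exact tsub_le_self

theorem one_sub_inv_conjExp_toReal {p : ℝ≥0∞} (hp : 1 ≤ p) :
    1 - ((conjExp p)⁻¹).toReal = (p⁻¹).toReal := by
  have h := congrArg ENNReal.toReal (inv_add_inv_conjExp hp)
  rw [ENNReal.toReal_add (ne_top_of_le_ne_top ENNReal.one_ne_top (ENNReal.inv_le_one.2 hp))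
    (ne_top_of_le_ne_top ENNReal.one_ne_top (ENNReal.inv_le_one.2 (one_le_conjExp p)))] at h
  simp only [ENNReal.toReal_one] at h
  linarith

/-- The square of the nuclear norm of a `2 × 2` matrix. -/
theorem sq_add_singularValues (M : Matrix (Fin 2) (Fin 2) ℝ) :
    ((Matrix.toEuclideanLin M).singularValues 0 + (Matrix.toEuclideanLin M).singularValues 1) ^ 2 =
      M 0 0 ^ 2 + M 0 1 ^ 2 + M 1 0 ^ 2 + M 1 1 ^ 2 + 2 * |M 0 0 * M 1 1 - M 0 1 * M 1 0| := by
  set T := Matrix.toEuclideanLin M with hT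
  have hfr : Module.finrank ℝ (EuclideanSpace ℝ (Fin 2)) = 2 := by simp
  have h0 := T.sq_singularValues_fin hfr 0
  have h1 := T.sq_singularValues_fin hfr 1
  have hn0 := T.singularValues_nonneg 0
  have hn1 := T.singularValues_nonneg 1
  -- The trace and determinant of `T* T` give `σ₀² + σ₁²` and `(σ₀ σ₁)²`, hence `σ₀ σ₁ = |det M|`.
  have htr := T.isSymmetric_adjoint_comp_self.trace_eq_sum_eigenvalues hfr
  have hdet := T.isSymmetric_adjoint_comp_self.det_eq_prod_eigenvalues hfr
  have hA : T.adjoint ∘ₗ T = Matrix.toEuclideanLin (M.conjTranspose * M) := by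
    rw [hT, ← Matrix.toEuclideanLin_conjTranspose_eq_adjoint]
    simp only [Matrix.toEuclideanLin_eq_toLin_orthonormal]
    exact (Matrix.toLin_mul _ _ _ _ _).symm
  simp only [Fin.sum_univ_two, Fin.prod_univ_two] at htr hdet
  rw [← h0, ← h1, hA, Matrix.toEuclideanLin_eq_toLin_orthonormal] at htr hdet
  simp only [Fin.val_zero, Fin.val_one] at htr hdet
  rw [LinearMap.trace_eq_matrix_trace ℝ (EuclideanSpace.basisFun (Fin 2) ℝ).toBasis,
    LinearMap.toMatrix_toLin] at htr
  rw [LinearMap.det_toLin] at hdet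
  simp [Matrix.trace, Matrix.mul_apply, Fin.sum_univ_two, Matrix.det_fin_two] at htr hdet
  have hprod : T.singularValues 0 * T.singularValues 1 = |M 0 0 * M 1 1 - M 0 1 * M 1 0| := by
    rw [← abs_of_nonneg (mul_nonneg hn0 hn1), ← sq_eq_sq_iff_abs_eq_abs]
    nlinarith
  nlinarith

theorem add_singularValues_le_schattenNorm {p : ℝ≥0∞} (hp : 1 ≤ p)
    (M : Matrix (Fin 2) (Fin 2) ℝ) :
    (Matrix.toEuclideanLin M).singularValues 0 + (Matrix.toEuclideanLin M).singularValues 1 ≤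
      2 ^ (p⁻¹).toReal * schattenNorm (conjExp p) M := by
  have h := sum_abs_le_ellNorm (one_le_conjExp p)
    fun i : Fin 2 => (Matrix.toEuclideanLin M).singularValues i
  rw [one_sub_inv_conjExp_toReal hp] at h
  simpa [Fin.sum_univ_two, abs_of_nonneg ((Matrix.toEuclideanLin M).singularValues_nonneg _),
    schattenNorm] using h

/-- Cauchy–Schwarz, with the Frobenius norm of `M` bounded by its nuclear norm. A crude bound
suffices: it only serves the small `h''` term. -/
theorem abs_sum_sq_mul_le {p : ℝ≥0∞} (hp : 1 ≤ p) {M : Matrix (Fin 2) (Fin 2) ℝ}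
    (hM : schattenNorm (conjExp p) M ≤ 1) (a : Fin 2 → ℝ) :
    |∑ i, ∑ j, M i j * (a i * a j)| ≤ 2 ^ (p⁻¹).toReal * (a 0 ^ 2 + a 1 ^ 2) := by
  have h1 := (add_singularValues_le_schattenNorm hp M).trans
    (mul_le_of_le_one_right (by positivity) hM)
  set K : ℝ := 2 ^ (p⁻¹).toReal
  have hK : 0 ≤ K := by positivity
  have h2 := sq_add_singularValues M
  have hn0 := (Matrix.toEuclideanLin M).singularValues_nonneg 0
  have hn1 := (Matrix.toEuclideanLin M).singularValues_nonneg 1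
  have h3 : M 0 0 ^ 2 + M 0 1 ^ 2 + M 1 0 ^ 2 + M 1 1 ^ 2 ≤ K ^ 2 := by
    have := pow_le_pow_left₀ (add_nonneg hn0 hn1) h1 2
    have := abs_nonneg (M 0 0 * M 1 1 - M 0 1 * M 1 0)
    linarith
  refine abs_le_of_sq_le_sq ?_ (by positivity)
  simp only [Fin.sum_univ_two]
  have hcs : (M 0 0 * (a 0 * a 0) + M 0 1 * (a 0 * a 1) +
      (M 1 0 * (a 1 * a 0) + M 1 1 * (a 1 * a 1))) ^ 2 ≤
      (M 0 0 ^ 2 + M 0 1 ^ 2 + M 1 0 ^ 2 + M 1 1 ^ 2) * (a 0 ^ 2 + a 1 ^ 2) ^ 2 := by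
    have := Finset.sum_mul_sq_le_sq_mul_sq Finset.univ ![M 0 0, M 0 1, M 1 0, M 1 1]
      ![a 0 * a 0, a 0 * a 1, a 1 * a 0, a 1 * a 1]
    simp [Fin.sum_univ_four] at this
    nlinarith
  rw [mul_pow]
  exact hcs.trans (by gcongr)

/-- With `θ = |a|²`, write `I - 2 a⊗a = (1 - θ) I + (θ I - 2 a⊗a)`, where the second summand is `θ`
times a reflection. Pairing `M` with the identity or with a reflection gives at most its nuclear
norm, and the weights `1 - θ` and `θ` sum to `1`. -/
theorem abs_trace_sub_le {p : ℝ≥0∞} (hp : 1 ≤ p) {M : Matrix (Fin 2) (Fin 2) ℝ}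
    (hM : schattenNorm (conjExp p) M ≤ 1) (a : Fin 2 → ℝ) (ha : a 0 ^ 2 + a 1 ^ 2 ≤ 1) :
    |∑ i, ∑ j, M i j * ((if i = j then 1 else 0) - 2 * (a i * a j))| ≤ 2 ^ (p⁻¹).toReal := by
  have h1 := (add_singularValues_le_schattenNorm hp M).trans
    (mul_le_of_le_one_right (by positivity) hM)
  set K : ℝ := 2 ^ (p⁻¹).toReal
  have hK : 0 ≤ K := by positivity
  have h2 := sq_add_singularValues M
  have hn0 := (Matrix.toEuclideanLin M).singularValues_nonneg 0
  have hn1 := (Matrix.toEuclideanLin M).singularValues_nonneg 1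
  have h3 := pow_le_pow_left₀ (add_nonneg hn0 hn1) h1 2
  have h4 := neg_abs_le (M 0 0 * M 1 1 - M 0 1 * M 1 0)
  have h5 := le_abs_self (M 0 0 * M 1 1 - M 0 1 * M 1 0)
  set θ := a 0 ^ 2 + a 1 ^ 2 with hθ
  have hθ0 : 0 ≤ θ := by positivity
  have htr : |M 0 0 + M 1 1| ≤ K := by
    refine abs_le_of_sq_le_sq ?_ hK
    nlinarith [sq_nonneg (M 0 1 - M 1 0)]
  have hsub : |(M 1 1 - M 0 0) * (a 0 ^ 2 - a 1 ^ 2) - (M 0 1 + M 1 0) * (2 * a 0 * a 1)| ≤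
      K * θ := by
    refine abs_le_of_sq_le_sq ?_ (by positivity)
    have e1 : (M 1 1 - M 0 0) ^ 2 + (M 0 1 + M 1 0) ^ 2 ≤ K ^ 2 := by nlinarith
    have e2 : ((M 1 1 - M 0 0) * (a 0 ^ 2 - a 1 ^ 2) - (M 0 1 + M 1 0) * (2 * a 0 * a 1)) ^ 2 ≤
        ((M 1 1 - M 0 0) ^ 2 + (M 0 1 + M 1 0) ^ 2) * θ ^ 2 := by
      have : θ ^ 2 = (a 0 ^ 2 - a 1 ^ 2) ^ 2 + (2 * a 0 * a 1) ^ 2 := by rw [hθ]; ring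
      rw [this]
      nlinarith [sq_nonneg ((M 1 1 - M 0 0) * (2 * a 0 * a 1) +
        (M 0 1 + M 1 0) * (a 0 ^ 2 - a 1 ^ 2))]
    rw [mul_pow]
    exact e2.trans (by gcongr)
  have hdec : ∑ i, ∑ j, M i j * ((if i = j then 1 else 0) - 2 * (a i * a j)) =
      (1 - θ) * (M 0 0 + M 1 1) +
      ((M 1 1 - M 0 0) * (a 0 ^ 2 - a 1 ^ 2) - (M 0 1 + M 1 0) * (2 * a 0 * a 1)) := by
    simp [Fin.sum_univ_two, hθ]
    ring
  rw [hdec]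
  refine (abs_add_le _ _).trans ?_
  rw [abs_mul, abs_of_nonneg (by linarith : 0 ≤ 1 - θ)]
  nlinarith [mul_le_mul_of_nonneg_left htr (by linarith : 0 ≤ 1 - θ)]

/-! ### The cutoff on the logarithmic scale -/

theorem exists_abs_deriv_deriv_smoothTransition_le :
    ∃ C, 0 < C ∧ ∀ t, |deriv (deriv Real.smoothTransition) t| ≤ C := by
  have hS : ContDiff ℝ 2 Real.smoothTransition := Real.smoothTransition.contDiff (n := 2)
  have hsupp : HasCompactSupport (deriv Real.smoothTransition) := by
    refine HasCompactSupport.intro (isCompact_Icc (a := (0 : ℝ)) (b := 1)) fun t ht => ?_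
    rw [Set.mem_Icc, not_and_or, not_le, not_le] at ht
    rcases ht with ht | ht
    · have : Real.smoothTransition =ᶠ[nhds t] fun _ => 0 := by
        filter_upwards [Iio_mem_nhds ht] with s hs
        exact Real.smoothTransition.zero_of_nonpos (le_of_lt hs)
      rw [this.deriv_eq, deriv_const]
    · have : Real.smoothTransition =ᶠ[nhds t] fun _ => 1 := by
        filter_upwards [Ioi_mem_nhds ht] with s hs
        exact Real.smoothTransition.one_of_one_le (le_of_lt hs)
      rw [this.deriv_eq, deriv_const]
  have hcont : Continuous (deriv (deriv Real.smoothTransition)) := by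
    have h1 : ContDiff ℝ 1 (deriv Real.smoothTransition) :=
      (contDiff_succ_iff_deriv (n := 1).1 hS).2.2
    exact h1.continuous_deriv le_rfl
  obtain ⟨C, hC⟩ := hcont.bounded_above_of_compact_support hsupp.deriv
  exact ⟨max C 1, by positivity, fun t => (hC t).trans (le_max_left _ _)⟩

/-- A smooth antitone cutoff on the logarithmic scale: it falls from `1` to `0` on `[a - L, a]`
and its second derivative is small compared with `1 / (L + 1)`. -/
theorem exists_cutoff (a : ℝ) {ε : ℝ} (hε : 0 < ε) :
    ∃ (L : ℝ) (h : ℝ → ℝ), 0 < L ∧ ContDiff ℝ ∞ h ∧ (∀ w, deriv h w ≤ 0) ∧ h (a - L) = 1 ∧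
      (∀ w, a ≤ w → h w = 0) ∧ ∀ w, |deriv (deriv h) w| * (L + 1) ≤ ε := by
  obtain ⟨C, hC0, hC⟩ := exists_abs_deriv_deriv_smoothTransition_le
  -- The second derivative is at most `C / L²`, and `L ≥ 1` gives `C (L + 1) / L² ≤ 2 C / L ≤ ε`.
  set L := 1 + 2 * C / ε with hL
  have hL1 : 1 ≤ L := by rw [hL]; have : 0 < 2 * C / ε := by positivity
                         linarith
  have hL0 : 0 < L := by linarith
  have hS : ContDiff ℝ ∞ Real.smoothTransition := Real.smoothTransition.contDiff (n := ⊤)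
  have hin : ∀ w, HasDerivAt (fun w => (a - w) / L) (-1 / L) w := fun w =>
    ((hasDerivAt_id w).const_sub a).div_const L
  have hS1 : ContDiff ℝ ∞ (deriv Real.smoothTransition) :=
    (contDiff_succ_iff_deriv (n := ∞).1 hS).2.2
  have hd1 : deriv (fun w => Real.smoothTransition ((a - w) / L)) =
      fun w => deriv Real.smoothTransition ((a - w) / L) * (-1 / L) := by
    ext w
    exact (((hS.differentiable (by simp)) _).hasDerivAt.comp w (hin w)).deriv
  refine ⟨L, fun w => Real.smoothTransition ((a - w) / L), hL0, ?_, ?_, ?_, ?_, ?_⟩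
  · exact hS.comp ((contDiff_const.sub contDiff_id).div_const L)
  · intro w
    rw [hd1]
    have := Real.smoothTransition.monotone.deriv_nonneg (x := (a - w) / L)
    have h2 : -1 / L ≤ 0 := div_nonpos_of_nonpos_of_nonneg (by norm_num) hL0.le
    exact mul_nonpos_of_nonneg_of_nonpos this h2
  · simp [hL0.ne']
  · intro w hw
    exact Real.smoothTransition.zero_of_nonpos
      (div_nonpos_of_nonpos_of_nonneg (by linarith) hL0.le)
  · intro w
    have hd2 : deriv (deriv (fun w => Real.smoothTransition ((a - w) / L))) w =
        deriv (deriv Real.smoothTransition) ((a - w) / L) * (-1 / L) * (-1 / L) := by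
      rw [hd1]
      exact ((((hS1.differentiable (by simp)) _).hasDerivAt.comp w (hin w)).mul_const _).deriv
    rw [hd2, abs_mul, abs_mul, abs_div, abs_neg, abs_one, abs_of_pos hL0]
    calc _ ≤ C * (1 / L) * (1 / L) * (L + 1) := by gcongr; exact hC _
      _ ≤ C * (1 / L) * (1 / L) * (2 * L) := by gcongr; linarith
      _ = 2 * C / L := by field_simp
      _ ≤ ε := by
        rw [div_le_iff₀ hL0, hL]
        field_simp
        linarith

/-! ### Derivatives of logarithmic radial functions -/

theorem partialDeriv_eq_of_hasFDerivAt {d : ℕ} {u : EuclideanSpace ℝ (Fin d) → ℝ}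
    {u' : EuclideanSpace ℝ (Fin d) →L[ℝ] ℝ} {z : EuclideanSpace ℝ (Fin d)}
    (h : HasFDerivAt u u' z) (i : Fin d) :
    partialDeriv i u z = u' (EuclideanSpace.single i 1) := by
  rw [partialDeriv, h.fderiv]

/-- The radial function `z ↦ h (log (|z - c|² + δ))`. -/
noncomputable def logRadial {d : ℕ} (h : ℝ → ℝ) (δ : ℝ) (c z : EuclideanSpace ℝ (Fin d)) : ℝ :=
  h (Real.log (‖z - c‖ ^ 2 + δ))

section LogRadial

variable {d : ℕ} {h : ℝ → ℝ} {δ : ℝ} (c z : EuclideanSpace ℝ (Fin d))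

theorem hasFDerivAt_norm_sub_sq_add :
    HasFDerivAt (fun z => ‖z - c‖ ^ 2 + δ) (2 • innerSL ℝ (z - c)) z := by
  have := (((hasFDerivAt_id z).sub_const c).norm_sq).add_const δ
  simpa using this

theorem hasFDerivAt_logRadial (hh : Differentiable ℝ h) (hδ : 0 < δ) :
    HasFDerivAt (logRadial h δ c)
      ((deriv h (Real.log (‖z - c‖ ^ 2 + δ)) * (‖z - c‖ ^ 2 + δ)⁻¹) • (2 • innerSL ℝ (z - c))) z := by
  have hρ : ‖z - c‖ ^ 2 + δ ≠ 0 := by positivity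
  have h1 : HasDerivAt (h ∘ Real.log) _ (‖z - c‖ ^ 2 + δ) :=
    (hh (Real.log (‖z - c‖ ^ 2 + δ))).hasDerivAt.comp _ (Real.hasDerivAt_log hρ)
  exact h1.comp_hasFDerivAt (f := fun z => ‖z - c‖ ^ 2 + δ) z (hasFDerivAt_norm_sub_sq_add c z)

theorem partialDeriv_logRadial (hh : Differentiable ℝ h) (hδ : 0 < δ) (j : Fin d) :
    partialDeriv j (logRadial h δ c) z =
      logRadial (deriv h) δ c z * ((‖z - c‖ ^ 2 + δ)⁻¹ * (2 * (z j - c j))) := by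
  rw [partialDeriv_eq_of_hasFDerivAt (hasFDerivAt_logRadial c z hh hδ)]
  simp [logRadial, EuclideanSpace.inner_single_right]
  ring

theorem partialDeriv_partialDeriv_logRadial (hh : ContDiff ℝ 2 h) (hδ : 0 < δ) (i j : Fin d) :
    partialDeriv i (partialDeriv j (logRadial h δ c)) z =
      2 / (‖z - c‖ ^ 2 + δ) *
        (logRadial (deriv h) δ c z * ((if i = j then 1 else 0) -
          2 * ((z i - c i) / √(‖z - c‖ ^ 2 + δ) * ((z j - c j) / √(‖z - c‖ ^ 2 + δ)))) +
        2 * logRadial (deriv (deriv h)) δ c z *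
          ((z i - c i) / √(‖z - c‖ ^ 2 + δ) * ((z j - c j) / √(‖z - c‖ ^ 2 + δ)))) := by
  have hρ : 0 < ‖z - c‖ ^ 2 + δ := by positivity
  have hh1 : ContDiff ℝ 1 (deriv h) := (contDiff_succ_iff_deriv (n := 1).1 hh).2.2
  have e1 : partialDeriv j (logRadial h δ c) = fun z =>
      logRadial (deriv h) δ c z * ((‖z - c‖ ^ 2 + δ)⁻¹ * (2 * (z j - c j))) :=
    funext fun z => partialDeriv_logRadial c z (hh.differentiable (by simp)) hδ j
  have hcoord : HasFDerivAt (fun z : EuclideanSpace ℝ (Fin d) => 2 * (z j - c j))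
      ((2 : ℝ) • (EuclideanSpace.proj j : EuclideanSpace ℝ (Fin d) →L[ℝ] ℝ)) z :=
    (((EuclideanSpace.proj j : EuclideanSpace ℝ (Fin d) →L[ℝ] ℝ).hasFDerivAt).sub_const
      (c j)).const_mul 2
  have hinv := (hasDerivAt_inv hρ.ne').comp_hasFDerivAt z (hasFDerivAt_norm_sub_sq_add (δ := δ) c z)
  have h2 := (hasFDerivAt_logRadial c z (hh1.differentiable (by simp)) hδ).mul (hinv.mul hcoord)
  rw [e1]
  refine (partialDeriv_eq_of_hasFDerivAt h2 i).trans ?_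
  have hs : √(‖z - c‖ ^ 2 + δ) ^ 2 = ‖z - c‖ ^ 2 + δ := Real.sq_sqrt hρ.le
  have hs0 : 0 < √(‖z - c‖ ^ 2 + δ) := Real.sqrt_pos.2 hρ
  simp only [logRadial]
  -- With the logarithm and the root opaque and `ρ = s²`, a rational identity remains.
  generalize Real.log (‖z - c‖ ^ 2 + δ) = l at *
  generalize √(‖z - c‖ ^ 2 + δ) = s at *
  rcases eq_or_ne i j with rfl | hij
  · simp [EuclideanSpace.inner_single_right, ← hs]
    field_simp
    ring
  · simp [EuclideanSpace.inner_single_right, ← hs, hij, hij.symm]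
    field_simp

theorem contDiff_logRadial (hh : ContDiff ℝ ∞ h) (hδ : 0 < δ) :
    ContDiff ℝ ∞ (logRadial h δ c) := by
  have h1 : ContDiff ℝ ∞ fun z => ‖z - c‖ ^ 2 + δ :=
    ((contDiff_id.sub contDiff_const).norm_sq ℝ).add contDiff_const
  exact hh.comp (h1.log fun z => by positivity)

end LogRadial

/-! ### Integration by parts against test fields -/

section Calculus

variable {d : ℕ} {u v : EuclideanSpace ℝ (Fin d) → ℝ}

theorem _root_.ContDiff.partialDeriv (hu : ContDiff ℝ ∞ u) (i : Fin d) :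
    ContDiff ℝ ∞ (partialDeriv i u) :=
  (hu.fderiv_right (m := ∞) (by simp)).clm_apply contDiff_const

theorem tsupport_partialDeriv_subset (i : Fin d) : tsupport (partialDeriv i u) ⊆ tsupport u := by
  have h : Function.support (partialDeriv i u) ⊆ Function.support (fderiv ℝ u) := by
    intro x hx hx'
    exact hx (by simp [partialDeriv, hx'])
  exact (closure_mono h).trans (tsupport_fderiv_subset ℝ)

theorem _root_.HasCompactSupport.partialDeriv (hu : HasCompactSupport u) (i : Fin d) :
    HasCompactSupport (partialDeriv i u) :=
  hu.of_isClosed_subset isClosed_closure (tsupport_partialDeriv_subset i)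

theorem integral_mul_partialDeriv (hu : ContDiff ℝ ∞ u) (hv : ContDiff ℝ ∞ v)
    (hv' : HasCompactSupport v) (i : Fin d) :
    ∫ z, u z * partialDeriv i v z = -∫ z, partialDeriv i u z * v z := by
  refine integral_mul_fderiv_eq_neg_fderiv_mul_of_integrable ?_ ?_ ?_
    (fun z _ => (hu.differentiable (by simp)) z) (fun z _ => (hv.differentiable (by simp)) z)
  · exact ((hu.partialDeriv i).continuous.mul hv.continuous).integrable_of_hasCompactSupport
      hv'.mul_left
  · exact (hu.continuous.mul (hv.partialDeriv i).continuous).integrable_of_hasCompactSupport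
      (hv'.partialDeriv i).mul_left
  · exact (hu.continuous.mul hv.continuous).integrable_of_hasCompactSupport hv'.mul_left

theorem integral_mul_partialDeriv_partialDeriv (hu : ContDiff ℝ ∞ u) (hv : ContDiff ℝ ∞ v)
    (hv' : HasCompactSupport v) (i j : Fin d) :
    ∫ z, u z * partialDeriv i (partialDeriv j v) z =
      ∫ z, v z * partialDeriv j (partialDeriv i u) z := by
  rw [integral_mul_partialDeriv hu (hv.partialDeriv j) (hv'.partialDeriv j),
    integral_mul_partialDeriv (hu.partialDeriv i) hv hv', neg_neg]
  simp only [mul_comm]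

end Calculus

/-- The integrand in the definition of the variation. -/
noncomputable def pairing {d : ℕ} (f : EuclideanSpace ℝ (Fin d) → ℝ)
    (F : EuclideanSpace ℝ (Fin d) → Matrix (Fin d) (Fin d) ℝ)
    (x : EuclideanSpace ℝ (Fin d)) : ℝ :=
  ∑ i, ∑ j, f x * partialDeriv i (partialDeriv j fun z => F z i j) x

section Pairing

variable {d : ℕ} {p : ℝ≥0∞} {A : Set (EuclideanSpace ℝ (Fin d))}
  {F : EuclideanSpace ℝ (Fin d) → Matrix (Fin d) (Fin d) ℝ}
  {f : EuclideanSpace ℝ (Fin d) → ℝ}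

theorem IsTestField.tsupport_partialDeriv_subset (hF : IsTestField p A F) (i j : Fin d) :
    tsupport (partialDeriv i (partialDeriv j fun z => F z i j)) ⊆ A :=
  ((HessianSchatten.tsupport_partialDeriv_subset i).trans
    (HessianSchatten.tsupport_partialDeriv_subset j)).trans (hF.tsupport_subset i j)

theorem IsTestField.integrableOn_mul (hF : IsTestField p A F)
    (hf : LocallyIntegrableOn f A volume) (i j : Fin d) :
    IntegrableOn (fun x => f x * partialDeriv i (partialDeriv j fun z => F z i j) x) A := by
  set w := partialDeriv i (partialDeriv j fun z => F z i j) with hw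
  have hwc : Continuous w := (((hF.contDiff i j).partialDeriv j).partialDeriv i).continuous
  have hws : IsCompact (tsupport w) := ((hF.hasCompactSupport i j).partialDeriv j).partialDeriv i
  have h1 : IntegrableOn f (tsupport w) :=
    hf.integrableOn_compact_subset (hF.tsupport_partialDeriv_subset i j) hws
  have h2 : IntegrableOn (fun x => f x * w x) (tsupport w) :=
    h1.mul_continuousOn hwc.continuousOn hws
  refine ((integrableOn_iff_integrable_of_support_subset ?_).1 h2).integrableOn
  intro x hx
  exact subset_tsupport _ (right_ne_zero_of_mul hx)

theorem IsTestField.integrableOn_pairing (hF : IsTestField p A F)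
    (hf : LocallyIntegrableOn f A volume) : IntegrableOn (pairing f F) A :=
  integrable_finsetSum _ fun i _ => integrable_finsetSum _ fun j _ => hF.integrableOn_mul hf i j

/-- The field is supported in `A`, so the integral extends to the whole space, and two integrations
by parts move the derivatives onto `f`, which needs no decay. -/
theorem IsTestField.setIntegral_pairing_eq (hF : IsTestField p A F) (hf : ContDiff ℝ ∞ f) :
    ∫ x in A, pairing f F x = ∫ x, ∑ i, ∑ j, F x i j * partialDeriv j (partialDeriv i f) x := by
  rw [setIntegral_eq_integral_of_forall_compl_eq_zero fun x hx => ?_]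
  · have hF' := fun i j => (((hF.hasCompactSupport i j).partialDeriv j).partialDeriv i)
    have hFc := fun i j => (((hF.contDiff i j).partialDeriv j).partialDeriv i).continuous
    have hi1 : ∀ i j, Integrable fun x =>
        f x * partialDeriv i (partialDeriv j fun z => F z i j) x := fun i j =>
      (hf.continuous.mul (hFc i j)).integrable_of_hasCompactSupport (hF' i j).mul_left
    have hi2 : ∀ i j, Integrable fun x => F x i j * partialDeriv j (partialDeriv i f) x :=
      fun i j => ((hF.contDiff i j).continuous.mul
        ((hf.partialDeriv i).partialDeriv j).continuous).integrable_of_hasCompactSupport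
          (hF.hasCompactSupport i j).mul_right
    simp only [pairing]
    rw [integral_finsetSum _ fun i _ => integrable_finsetSum _ fun j _ => hi1 i j,
      integral_finsetSum _ fun i _ => integrable_finsetSum _ fun j _ => hi2 i j]
    refine Finset.sum_congr rfl fun i _ => ?_
    rw [integral_finsetSum _ fun j _ => hi1 i j, integral_finsetSum _ fun j _ => hi2 i j]
    exact Finset.sum_congr rfl fun j _ => integral_mul_partialDeriv_partialDeriv hf
      (hF.contDiff i j) (hF.hasCompactSupport i j) i j
  · refine Finset.sum_eq_zero fun i _ => Finset.sum_eq_zero fun j _ => ?_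
    rw [image_eq_zero_of_notMem_tsupport fun h => hx (hF.tsupport_partialDeriv_subset i j h),
      mul_zero]

end Pairing

/-! ### The cost of a bump -/

/-- Polar coordinates, then the substitution `w = log (r² + δ)`, for which `dw = 2 r / (r² + δ) dr`.
-/
theorem integral_radial_log (g : ℝ → ℝ) (hg : Continuous g) {R δ : ℝ} (hR : 0 < R) (hδ : 0 < δ)
    (hg0 : ∀ w, Real.log (R ^ 2) ≤ w → g w = 0) (c : EuclideanSpace ℝ (Fin 2)) :
    ∫ x, 2 / (‖x - c‖ ^ 2 + δ) * logRadial g δ c x =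
      2 * Real.pi * ∫ w in Real.log δ..Real.log (R ^ 2 + δ), g w := by
  have hfr : Module.finrank ℝ (EuclideanSpace ℝ (Fin 2)) = 2 := by simp
  have hpos : ∀ r : ℝ, 0 < r ^ 2 + δ := fun r => by positivity
  have hsub := intervalIntegral.integral_comp_mul_deriv (a := 0) (b := R)
    (f := fun r => Real.log (r ^ 2 + δ)) (f' := fun r => (2 * r) / (r ^ 2 + δ)) (g := g)
    (fun r _ => by
      have h1 : HasDerivAt (fun r : ℝ => r ^ 2 + δ) (2 * r) r := by
        simpa using (hasDerivAt_pow 2 r).add_const δ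
      exact h1.log (hpos r).ne')
    (by
      refine Continuous.continuousOn ?_
      exact (continuous_const.mul continuous_id).div (by fun_prop) fun r => (hpos r).ne') hg
  simp only [Function.comp_def, ne_eq, OfNat.ofNat_ne_zero, not_false_eq_true, zero_pow,
    zero_add] at hsub
  have hvol : (volume : Measure (EuclideanSpace ℝ (Fin 2))).real (Metric.ball 0 1) = Real.pi := by
    simp [Measure.real, EuclideanSpace.volume_ball_fin_two, Real.pi_pos.le]
  have hrad := integral_fun_norm_addHaar (volume : Measure (EuclideanSpace ℝ (Fin 2)))
    (fun r => 2 / (r ^ 2 + δ) * g (Real.log (r ^ 2 + δ)))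
  rw [hfr, hvol] at hrad
  have htr := integral_sub_right_eq_self (μ := (volume : Measure (EuclideanSpace ℝ (Fin 2))))
    (fun x => 2 / (‖x‖ ^ 2 + δ) * g (Real.log (‖x‖ ^ 2 + δ))) c
  simp only [logRadial]
  rw [htr, hrad, ← hsub, intervalIntegral.integral_of_le hR.le,
    setIntegral_eq_of_subset_of_forall_sdiff_eq_zero measurableSet_Ioi
      (Set.Ioc_subset_Ioi_self : Set.Ioc 0 R ⊆ Set.Ioi 0)]
  · simp only [nsmul_eq_mul, smul_eq_mul, Nat.cast_ofNat, mul_assoc]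
    congr 3
    ext r
    ring
  · intro r hr
    have hr' : R < r := by
      by_contra hcon
      exact hr.2 ⟨hr.1, not_lt.1 hcon⟩
    rw [hg0, mul_zero, smul_zero]
    refine Real.log_le_log (by positivity) ?_
    nlinarith

theorem log_sq_le_of_le_norm {R δ : ℝ} (hR : 0 < R) (hδ : 0 < δ) {d : ℕ}
    {c z : EuclideanSpace ℝ (Fin d)} (h : R ≤ ‖z - c‖) :
    Real.log (R ^ 2) ≤ Real.log (‖z - c‖ ^ 2 + δ) :=
  Real.log_le_log (by positivity) (by nlinarith)

/-- A compactly supported bump with value `1` at its centre whose Hessian--Schatten variation is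
almost `2π 2^{1/p}`: a smoothed truncated logarithm. -/
theorem exists_bump {p : ℝ≥0∞} (hp : 1 ≤ p) {R ε : ℝ} (hR : 0 < R) (hε : 0 < ε) :
    ∃ φ : EuclideanSpace ℝ (Fin 2) → EuclideanSpace ℝ (Fin 2) → ℝ,
      (∀ c, ContDiff ℝ ∞ (φ c)) ∧ (∀ c, φ c c = 1) ∧ (∀ c z, R ≤ ‖z - c‖ → φ c z = 0) ∧
      ∀ c A F, IsTestField p A F →
        |∫ x in A, pairing (φ c) F x| ≤ 2 * Real.pi * 2 ^ (p⁻¹).toReal * (1 + ε) := by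
  obtain ⟨L, h, hL, hh, hanti, h1, h0, h2⟩ := exists_cutoff (Real.log (R ^ 2)) (half_pos hε)
  -- Chosen so that `log δ = log (R²) - L`: the centre of the bump sits where `h = 1`.
  set δ := R ^ 2 * Real.exp (-L) with hδdef
  have hδ : 0 < δ := by positivity
  have hlogδ : Real.log δ = Real.log (R ^ 2) - L := by
    rw [hδdef, Real.log_mul (by positivity) (by positivity), Real.log_exp, sub_eq_add_neg]
  have hδR : δ ≤ R ^ 2 := by
    rw [hδdef]
    exact mul_le_of_le_one_right (by positivity) (Real.exp_le_one_iff.2 (by linarith))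
  have hcd1 : ContDiff ℝ ∞ (deriv h) := (contDiff_succ_iff_deriv (n := ∞).1 hh).2.2
  have hcd2 : ContDiff ℝ ∞ (deriv (deriv h)) := (contDiff_succ_iff_deriv (n := ∞).1 hcd1).2.2
  set g : ℝ → ℝ := fun w => |deriv h w| + 2 * |deriv (deriv h) w| with hg
  have hgc : Continuous g := hcd1.continuous.abs.add (continuous_const.mul hcd2.continuous.abs)
  set a := Real.log (R ^ 2) with ha
  -- The derivatives of `h` vanish beyond `a` by local constancy; continuity adds the endpoint `a`.
  have hIci : ∀ u : ℝ → ℝ, Continuous u → (∀ w, a < w → u w = 0) → ∀ w, a ≤ w → u w = 0 := by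
    intro u hu hz w hw
    have : Set.EqOn u 0 (closure (Set.Ioi a)) := Set.EqOn.closure (fun w hw => hz w hw) hu continuous_const
    rw [closure_Ioi] at this
    exact this hw
  have hd0 : ∀ w, a ≤ w → deriv h w = 0 := hIci _ hcd1.continuous fun w hw => by
    have : h =ᶠ[nhds w] fun _ => 0 := by
      filter_upwards [Ioi_mem_nhds hw] with s hs using h0 s (le_of_lt hs)
    rw [this.deriv_eq, deriv_const]
  have hdd0 : ∀ w, a ≤ w → deriv (deriv h) w = 0 := hIci _ hcd2.continuous fun w hw => by
    have : deriv h =ᶠ[nhds w] fun _ => 0 := by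
      filter_upwards [Ioi_mem_nhds hw] with s hs using hd0 s (le_of_lt hs)
    rw [this.deriv_eq, deriv_const]
  have hg0 : ∀ w, a ≤ w → g w = 0 := fun w hw => by simp [hg, hd0 w hw, hdd0 w hw]
  set b := Real.log (R ^ 2 + δ) with hb
  have hab : a ≤ b := Real.log_le_log (by positivity) (by linarith)
  -- So `[log δ, b]` has length at most `L + 1`, the factor built into the cutoff.
  have hba : b ≤ a + 1 := by
    have : b ≤ Real.log (R ^ 2 * 2) := Real.log_le_log (by positivity) (by linarith)
    rw [Real.log_mul (by positivity) (by norm_num)] at this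
    linarith [Real.log_two_lt_d9]
  have hgint : ∫ w in Real.log δ..b, g w ≤ 1 + ε := by
    have hle : Real.log δ ≤ b := by linarith
    have e1 : ∫ w in Real.log δ..b, -deriv h w = 1 := by
      rw [intervalIntegral.integral_neg, intervalIntegral.integral_deriv_eq_sub
        (fun w _ => (hh.differentiable (by simp)) w) (hcd1.continuous.intervalIntegrable _ _),
        h0 b hab, hlogδ, h1]
      norm_num
    calc ∫ w in Real.log δ..b, g w ≤ ∫ w in Real.log δ..b, (-deriv h w + ε / (L + 1)) := by
          refine intervalIntegral.integral_mono_on hle (hgc.intervalIntegrable _ _)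
            ((hcd1.continuous.neg.add continuous_const).intervalIntegrable _ _) fun w _ => ?_
          have := h2 w
          rw [← le_div_iff₀ (by linarith)] at this
          rw [hg]
          simp only [abs_of_nonpos (hanti w)]
          have e : ε / (L + 1) = 2 * (ε / 2 / (L + 1)) := by ring
          rw [e]
          gcongr
      _ = 1 + (b - Real.log δ) * (ε / (L + 1)) := by
          rw [intervalIntegral.integral_add (f := fun w => -deriv h w)
            (hcd1.continuous.neg.intervalIntegrable _ _)
            (continuous_const.intervalIntegrable _ _), e1, intervalIntegral.integral_const,
            smul_eq_mul]
      _ ≤ 1 + (L + 1) * (ε / (L + 1)) := by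
          gcongr
          linarith
      _ = 1 + ε := by field_simp
  refine ⟨logRadial h δ, fun c => contDiff_logRadial c hh hδ, fun c => ?_, fun c z hz => ?_,
    fun c A F hF => ?_⟩
  · simp [logRadial, hlogδ, h1]
  · exact h0 _ (log_sq_le_of_le_norm hR hδ hz)
  · set K : ℝ := 2 ^ (p⁻¹).toReal with hK
    have hK0 : 0 ≤ K := by positivity
    rw [hF.setIntegral_pairing_eq (contDiff_logRadial c hh hδ)]
    have hlc : Continuous fun x => ‖x - c‖ ^ 2 + δ := by fun_prop
    have hpos : ∀ x, 0 < ‖x - c‖ ^ 2 + δ := fun x => by positivity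
    have hint : Integrable fun x => K * (2 / (‖x - c‖ ^ 2 + δ) * logRadial g δ c x) := by
      refine Continuous.integrable_of_hasCompactSupport ?_ ?_
      · exact continuous_const.mul ((continuous_const.div hlc fun x => (hpos x).ne').mul
          (hgc.comp (hlc.log fun x => (hpos x).ne')))
      · refine HasCompactSupport.intro (isCompact_closedBall c R) fun x hx => ?_
        rw [Metric.mem_closedBall, not_le, dist_eq_norm] at hx
        rw [logRadial, hg0 _ (log_sq_le_of_le_norm hR hδ hx.le), mul_zero, mul_zero]
    have hbound : ∀ x, ‖∑ i, ∑ j, F x i j * partialDeriv j (partialDeriv i (logRadial h δ c)) x‖ ≤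
        K * (2 / (‖x - c‖ ^ 2 + δ) * logRadial g δ c x) := by
      intro x
      set α : Fin 2 → ℝ := fun i => (x i - c i) / √(‖x - c‖ ^ 2 + δ) with hα
      have hα1 : α 0 ^ 2 + α 1 ^ 2 ≤ 1 := by
        simp only [hα, div_pow, Real.sq_sqrt (hpos x).le, ← add_div]
        rw [div_le_one (hpos x), EuclideanSpace.real_norm_sq_eq, Fin.sum_univ_two]
        simp only [PiLp.sub_apply]
        linarith
      have b1 := abs_trace_sub_le hp (hF.norm_le x) α hα1
      have b2 := (abs_sum_sq_mul_le hp (hF.norm_le x) α).trans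
        (mul_le_of_le_one_right hK0 hα1)
      have e : ∑ i, ∑ j, F x i j * partialDeriv j (partialDeriv i (logRadial h δ c)) x =
          2 / (‖x - c‖ ^ 2 + δ) * (logRadial (deriv h) δ c x *
            (∑ i, ∑ j, F x i j * ((if i = j then 1 else 0) - 2 * (α i * α j))) +
            2 * logRadial (deriv (deriv h)) δ c x * ∑ i, ∑ j, F x i j * (α i * α j)) := by
        simp only [partialDeriv_partialDeriv_logRadial c x (contDiff_infty.1 hh 2) hδ,
          Fin.sum_univ_two, hα]
        simp
        ring
      rw [e, Real.norm_eq_abs, abs_mul, abs_of_pos (div_pos two_pos (hpos x)), mul_left_comm]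
      refine mul_le_mul_of_nonneg_left ?_ (div_pos two_pos (hpos x)).le
      refine (abs_add_le _ _).trans ?_
      rw [abs_mul, abs_mul, abs_mul, abs_two]
      have : K * logRadial g δ c x = |logRadial (deriv h) δ c x| * K +
          2 * |logRadial (deriv (deriv h)) δ c x| * K := by
        simp only [logRadial, hg]
        ring
      rw [this]
      gcongr
    refine (norm_integral_le_of_norm_le hint (Filter.Eventually.of_forall hbound)).trans ?_
    rw [integral_const_mul, integral_radial_log g hgc hR hδ hg0 c]
    calc K * (2 * Real.pi * ∫ w in Real.log δ..b, g w) ≤ K * (2 * Real.pi * (1 + ε)) := by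
          have := Real.pi_pos
          gcongr
      _ = _ := by ring

/-! ### Subtracting bumps from a competitor -/

section ContRep

variable {d : ℕ} {Ω : Set (EuclideanSpace ℝ (Fin d))} {f g φ : EuclideanSpace ℝ (Fin d) → ℝ}

theorem IsContRep.sub (h : IsContRep Ω f g) (hφ : Continuous φ) :
    IsContRep Ω (fun z => f z - φ z) (fun z => g z - φ z) :=
  ⟨h.1.sub hφ.continuousOn, h.2.sub (ae_eq_refl φ)⟩

/-- If `f` has no continuous representative, neither has `f - φ`, and both sides use the raw values.
Hence no regularity of competitors is needed. -/
theorem contRep_sub (hΩ : IsOpen Ω) (hφ : Continuous φ) {x : EuclideanSpace ℝ (Fin d)}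
    (hx : x ∈ Ω) : contRep Ω (fun z => f z - φ z) x = contRep Ω f x - φ x := by
  by_cases h : ∃ g, IsContRep Ω f g
  · obtain ⟨g, hg⟩ := h
    rw [contRep_eq hΩ hg hx, contRep_eq hΩ (hg.sub hφ) hx]
  · have h' : ¬∃ g, IsContRep Ω (fun z => f z - φ z) g := fun ⟨g, hg⟩ =>
      h ⟨_, by simpa using hg.sub hφ.neg⟩
    rw [contRep, contRep, dif_neg h, dif_neg h']

end ContRep

/-- The pairing is linear in `f`, and truncation at zero is subadditive. The bound on bumps is
two-sided because the `e k` have arbitrary sign. -/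
theorem variation_sub_sum_le {p : ℝ≥0∞} {d N : ℕ} {A : Set (EuclideanSpace ℝ (Fin d))}
    {f : EuclideanSpace ℝ (Fin d) → ℝ} (hf : LocallyIntegrableOn f A volume)
    {φ : Fin N → EuclideanSpace ℝ (Fin d) → ℝ} (hφ : ∀ k, Continuous (φ k)) {B : ℝ}
    (hB : ∀ k F, IsTestField p A F → |∫ x in A, pairing (φ k) F x| ≤ B) (e : Fin N → ℝ) :
    variation p (fun z => f z - ∑ k, e k * φ k z) A ≤
      variation p f A + ENNReal.ofReal ((∑ k, |e k|) * B) := by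
  refine iSup₂_le fun F hF => ?_
  have hpt : ∀ x, ∑ i, ∑ j, (f x - ∑ k, e k * φ k x) *
      partialDeriv i (partialDeriv j fun z => F z i j) x =
      pairing f F x - ∑ k, e k * pairing (φ k) F x := by
    intro x
    simp only [pairing, ← Finset.mul_sum, ← mul_assoc, ← Finset.sum_mul]
    ring
  have hik : ∀ k, IntegrableOn (fun x => e k * pairing (φ k) F x) A := fun k =>
    (hF.integrableOn_pairing ((hφ k).locallyIntegrable.locallyIntegrableOn A)).const_mul (e k)
  have hint : ∫ x in A, ∑ i, ∑ j, (f x - ∑ k, e k * φ k x) *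
      partialDeriv i (partialDeriv j fun z => F z i j) x =
      (∫ x in A, pairing f F x) - ∑ k, e k * ∫ x in A, pairing (φ k) F x := by
    simp only [hpt]
    rw [integral_sub (hF.integrableOn_pairing hf) (integrable_finsetSum _ fun k _ => hik k),
      integral_finsetSum _ fun k _ => hik k]
    simp only [integral_const_mul]
  have hsum : -∑ k, e k * ∫ x in A, pairing (φ k) F x ≤ (∑ k, |e k|) * B := by
    rw [Finset.sum_mul]
    refine (neg_le_abs _).trans ((Finset.abs_sum_le_sum_abs _ _).trans
      (Finset.sum_le_sum fun k _ => ?_))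
    rw [abs_mul]
    exact mul_le_mul_of_nonneg_left (hB k F hF) (abs_nonneg _)
  rw [hint]
  calc _ ≤ ENNReal.ofReal ((∫ x in A, pairing f F x) + (∑ k, |e k|) * B) :=
        ENNReal.ofReal_le_ofReal (by linarith)
    _ ≤ ENNReal.ofReal (∫ x in A, pairing f F x) + ENNReal.ofReal ((∑ k, |e k|) * B) :=
        ENNReal.ofReal_add_le
    _ ≤ _ := by
        gcongr
        exact le_iSup₂ (f := fun (F : EuclideanSpace ℝ (Fin d) → Matrix (Fin d) (Fin d) ℝ)
          (_ : IsTestField p A F) => ENNReal.ofReal (∫ x in A, pairing f F x)) F hF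

theorem exists_pos_forall_le_norm_sub {E : Type*} [NormedAddCommGroup E] {ι : Type*} [Finite ι]
    {x : ι → E} (hx : Function.Injective x) :
    ∃ R : ℝ, 0 < R ∧ ∀ i j, i ≠ j → R ≤ ‖x i - x j‖ := by
  have h : ∀ᶠ R in nhdsWithin (0 : ℝ) (Set.Ioi 0), ∀ i j, i ≠ j → R ≤ ‖x i - x j‖ := by
    refine Filter.eventually_all.2 fun i => Filter.eventually_all.2 fun j => ?_
    by_cases hij : i = j
    · simp [hij]
    · have hpos : 0 < ‖x i - x j‖ := norm_pos_iff.2 (sub_ne_zero.2 (hx.ne hij))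
      filter_upwards [Ioc_mem_nhdsGT hpos] with R hR _ using hR.2
  obtain ⟨R, hR, hR0⟩ := (h.and self_mem_nhdsWithin).exists
  exact ⟨R, hR0, hR⟩

theorem ellNorm_zero {q : ℝ≥0∞} (hq : 1 ≤ q) (n : ℕ) : ellNorm q (fun _ : Fin n => 0) = 0 := by
  have : Fact (1 ≤ q) := ⟨hq⟩
  exact norm_zero (E := PiLp q fun _ : Fin n => ℝ)

theorem ellNorm_pos {q : ℝ≥0∞} (hq : 1 ≤ q) {n : ℕ} {v : Fin n → ℝ} (hv : v ≠ 0) :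
    0 < ellNorm q v := by
  have : Fact (1 ≤ q) := ⟨hq⟩
  exact norm_pos_iff.2 fun h => hv (by simpa using h)

/-! ### Comparison of the infima -/

section Functional

variable {Ω : Set (EuclideanSpace ℝ (Fin 2))} {N : ℕ} {x : Fin N → EuclideanSpace ℝ (Fin 2)}
  {y : Fin N → ℝ} {p q q' lam : ℝ≥0∞}

/-- At `λ = ∞` only the vanishing of the residual matters, and this does not depend on `q`. -/
theorem functional_top_congr (hq : 1 ≤ q) (hq' : 1 ≤ q') (f : EuclideanSpace ℝ (Fin 2) → ℝ) :
    functional Ω x y p q ⊤ f = functional Ω x y p q' ⊤ f := by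
  unfold functional
  by_cases h : (fun i => contRep Ω f (x i) - y i) = 0
  · rw [h]
    congr 3
    exact (ellNorm_zero hq N).trans (ellNorm_zero hq' N).symm
  · rw [ENNReal.top_mul (by simpa using ellNorm_pos hq h),
      ENNReal.top_mul (by simpa using ellNorm_pos hq' h)]

theorem infFunctional_top_congr (hq : 1 ≤ q) (hq' : 1 ≤ q') :
    infFunctional Ω x y p q ⊤ = infFunctional Ω x y p q' ⊤ := by
  simp only [infFunctional, functional_top_congr hq hq']

theorem infFunctional_le_top : infFunctional Ω x y p q lam ≤ infFunctional Ω x y p q ⊤ := by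
  refine iInf₂_mono fun f _ => ?_
  unfold functional
  gcongr
  exact le_top

theorem sum_abs_mul_le_threshold_mul (hq : 1 ≤ q) (e : Fin N → ℝ) :
    (∑ i, |e i|) * (2 * Real.pi * 2 ^ (p⁻¹).toReal) ≤ threshold N p q * ellNorm q e := by
  have h := mul_le_mul_of_nonneg_left (sum_abs_le_ellNorm hq e)
    (by positivity : 0 ≤ 2 * Real.pi * (2 : ℝ) ^ (p⁻¹).toReal)
  rw [threshold, mul_assoc _ ((N : ℝ) ^ _)]
  linarith

/-- Subtracting a combination of bumps centred at the data points turns every competitor into one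
that fits the data exactly. -/
theorem infFunctional_top_le (hΩ : IsOpen Ω) (hxΩ : ∀ i, x i ∈ Ω) (hx : Function.Injective x)
    (hp : 1 ≤ p) (hq : 1 ≤ q) (hlam : ENNReal.ofReal (threshold N p q) ≤ lam) :
    infFunctional Ω x y p q ⊤ ≤ infFunctional Ω x y p q lam := by
  refine le_iInf₂ fun f hf => ENNReal.le_of_forall_pos_le_add fun ε hε _ => ?_
  set e : Fin N → ℝ := fun i => contRep Ω f (x i) - y i with he
  set T : ℝ := 2 * Real.pi * 2 ^ (p⁻¹).toReal with hT
  have hT0 : 0 < T := by positivity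
  set S : ℝ := ∑ i, |e i| with hS
  have hS0 : 0 ≤ S := Finset.sum_nonneg fun i _ => abs_nonneg _
  obtain ⟨R, hR, hRx⟩ := exists_pos_forall_le_norm_sub hx
  -- This relative error turns into an additive error `S T ε / (S T + 1) ≤ ε`; the `+ 1` covers `S =
  -- 0`.
  have hε' : 0 < (ε : ℝ) / (S * T + 1) := by positivity
  obtain ⟨φ, hφ, hφ1, hφ0, hφB⟩ := exists_bump hp hR hε'
  set ψ : EuclideanSpace ℝ (Fin 2) → ℝ := fun z => ∑ k, e k * φ (x k) z with hψ
  have hψc : Continuous ψ :=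
    continuous_finsetSum _ fun k _ => continuous_const.mul (hφ (x k)).continuous
  have hfit : (fun i => contRep Ω (fun z => f z - ψ z) (x i) - y i) = fun _ => 0 := by
    funext i
    have : ψ (x i) = e i := by
      rw [hψ]
      simp only
      rw [Finset.sum_eq_single i (fun k _ hk => by rw [hφ0 _ _ (hRx i k hk.symm), mul_zero])
        (by simp), hφ1, mul_one]
    rw [contRep_sub hΩ hψc (hxΩ i), this, he]
    ring
  have hfun : functional Ω x y p q ⊤ (fun z => f z - ψ z) = variation p (fun z => f z - ψ z) Ω := by
    rw [functional, hfit, ellNorm_zero hq, ENNReal.ofReal_zero, mul_zero, add_zero]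
  have hsum : S * (T * (1 + ε / (S * T + 1))) ≤ threshold N p q * ellNorm q e + ε := by
    have h1 := sum_abs_mul_le_threshold_mul (p := p) hq e
    have h2 : S * T * (ε / (S * T + 1)) ≤ ε := by
      rw [mul_div_assoc', div_le_iff₀ (by positivity)]
      nlinarith [ε.coe_nonneg]
    linarith
  calc infFunctional Ω x y p q ⊤ ≤ functional Ω x y p q ⊤ (fun z => f z - ψ z) :=
        iInf₂_le (f := fun (f : EuclideanSpace ℝ (Fin 2) → ℝ)
          (_ : LocallyIntegrableOn f Ω volume) => functional Ω x y p q ⊤ f) _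
          (hf.sub (hψc.locallyIntegrable.locallyIntegrableOn Ω))
    _ ≤ variation p f Ω + ENNReal.ofReal (S * (T * (1 + ε / (S * T + 1)))) := by
        rw [hfun]
        exact variation_sub_sum_le hf (fun k => (hφ (x k)).continuous)
          (fun k F hF => hφB (x k) Ω F hF) e
    _ ≤ variation p f Ω + (ENNReal.ofReal (threshold N p q * ellNorm q e) + ε) := by
        gcongr
        refine (ENNReal.ofReal_le_ofReal hsum).trans (ENNReal.ofReal_add_le.trans ?_)
        rw [ENNReal.ofReal_coe_nnreal]
    _ ≤ functional Ω x y p q lam f + ε := by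
        rw [functional, ← add_assoc, ENNReal.ofReal_mul (by unfold threshold; positivity)]
        gcongr

theorem infFunctional_eq_top (hΩ : IsOpen Ω) (hxΩ : ∀ i, x i ∈ Ω) (hx : Function.Injective x)
    (hp : 1 ≤ p) (hq : 1 ≤ q) (hlam : ENNReal.ofReal (threshold N p q) ≤ lam) :
    infFunctional Ω x y p q lam = infFunctional Ω x y p q ⊤ :=
  infFunctional_le_top.antisymm (infFunctional_top_le hΩ hxΩ hx hp hq hlam)

end Functional

end HessianSchatten

theorem proposition4p4 (Ω : Set (EuclideanSpace ℝ (Fin 2))) (hΩ : IsOpen Ω) {N : ℕ}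
    (x : Fin N → EuclideanSpace ℝ (Fin 2)) (hxΩ : ∀ i, x i ∈ Ω)
    (hx : Function.Injective x) (y : Fin N → ℝ) (p : ℝ≥0∞) (hp : 1 ≤ p) :
    (∀ q lam : ℝ≥0∞, 1 ≤ q → ENNReal.ofReal (HessianSchatten.threshold N p q) ≤ lam →
      HessianSchatten.infFunctional Ω x y p q lam =
        HessianSchatten.infFunctional Ω x y p q ∞) ∧
    (∀ q lam q' lam' : ℝ≥0∞, 1 ≤ q → 1 ≤ q' →
      ENNReal.ofReal (HessianSchatten.threshold N p q) ≤ lam →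
      ENNReal.ofReal (HessianSchatten.threshold N p q') ≤ lam' →
      HessianSchatten.infFunctional Ω x y p q lam =
        HessianSchatten.infFunctional Ω x y p q' lam') := by
  have key : ∀ q lam : ℝ≥0∞, 1 ≤ q → ENNReal.ofReal (HessianSchatten.threshold N p q) ≤ lam →
      HessianSchatten.infFunctional Ω x y p q lam = HessianSchatten.infFunctional Ω x y p q ⊤ :=
    fun q lam hq hlam => HessianSchatten.infFunctional_eq_top hΩ hxΩ hx hp hq hlam
  refine ⟨key, fun q lam q' lam' hq hq' hlam hlam' => ?_⟩
  rw [key q lam hq hlam, key q' lam' hq' hlam', HessianSchatten.infFunctional_top_congr hq hq']
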